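/- \textbf{Theorem (Hudson).} For $f\in L^2(\mathbb{R}^d)$ let $$Wf(x,\omega)=\int_{\mathbb{R}^d} f\!\left(x+\tfrac t2\right)\overline{f\!\left(x-\tfrac t2\right)}\,e^{-2\pi i\,\omega\cdot t}\,dt,\qquad (x,\omega)\in\mathbb{R}^{2d},$$ be its Wigner distribution. Then $Wf(x,\omega)>0$ for all $(x,\omega)\in\mathbb{R}^{2d}$ (i.e. $Wf(x,\omega)$ is real and positive) if and only if $f$ is a generalized Gaussian, i.e. for almost every $t\in\mathbb{R}^d$ $$f(t)=e^{-\pi t\cdot At+2\pi b\cdot t+c},$$ where $A\in GL(\mathbb{C},d)$ is an invertible complex symmetric matrix ($A^T=A$) whose entrywise real part is positive definite ($\Re(A)>0$), $b\in\mathbb{C}^d$, $c\in\mathbb{C}$, and $u\cdot v=\sum_{j}u_jv_j$. -/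

import Mathlib

open MeasureTheory
open scoped ComplexOrder Matrix

noncomputable section

/-- The Wigner distribution
`W f (x, ω) = ∫ f (x + t/2) * conj (f (x - t/2)) * exp (-2πi ω·t) dt` over `t ∈ ℝᵈ`.
For `f ∈ L²` the integrand is integrable for every `(x, ω)`. -/
def wigner {d : ℕ} (f : EuclideanSpace ℝ (Fin d) → ℂ) (x ω : EuclideanSpace ℝ (Fin d)) : ℂ :=
  ∫ t : EuclideanSpace ℝ (Fin d),
    f (x + (1 / 2 : ℝ) • t) * (starRingEnd ℂ) (f (x - (1 / 2 : ℝ) • t)) *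
      Complex.exp (-2 * (Real.pi : ℂ) * Complex.I * ((inner ℝ ω t : ℝ) : ℂ))

/-- A real vector regarded as a complex one. -/
def complexVec {d : ℕ} (t : EuclideanSpace ℝ (Fin d)) : Fin d → ℂ := fun i => ((t i : ℝ) : ℂ)

/-- The function `t ↦ exp (-π t·At + 2π b·t + c)` on `ℝᵈ`, where the dot is the bilinear
product `u·v = ∑ i, u i * v i`. -/
def gaussianFun {d : ℕ} (A : Matrix (Fin d) (Fin d) ℂ) (b : Fin d → ℂ) (c : ℂ)
    (t : EuclideanSpace ℝ (Fin d)) : ℂ :=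
  Complex.exp (-(Real.pi : ℂ) * (complexVec t ⬝ᵥ (A *ᵥ complexVec t)) +
    2 * (Real.pi : ℂ) * (b ⬝ᵥ complexVec t) + c)

/-- `f` is (almost everywhere equal to) a generalized Gaussian `exp (-π t·At + 2π b·t + c)`, with
`A` an invertible complex symmetric matrix whose (entrywise) real part is positive definite. -/
def IsGeneralizedGaussian {d : ℕ} (f : EuclideanSpace ℝ (Fin d) → ℂ) : Prop :=
  ∃ (A : Matrix (Fin d) (Fin d) ℂ) (b : Fin d → ℂ) (c : ℂ),
    IsUnit A ∧ A.IsSymm ∧ (A.map Complex.re).PosDef ∧ f =ᵐ[volume] gaussianFun A b c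

end

/-!
A square-integrable function is a generalized Gaussian exactly when its Wigner distribution is
positive everywhere.

The Wigner distribution of a Gaussian is, for fixed `x`, the Fourier transform of a real Gaussian in
`t`, which is positive (`wigner_gaussianFun_pos`, using the Gaussian integral
`exists_integral_gaussianFun_eq`, obtained by diagonalizing the real and imaginary parts of the
matrix simultaneously).

For the converse put `g t = f t * exp (-π ‖t‖²)`. Pairing `W f > 0` with the Wigner distribution
of a translated and modulated Gaussian, which is positive too, shows through Moyal's identity that
the Laplace transform `z ↦ ∫ g t * exp (z ⟪w, t⟫) dt` has no zeros
(`integral_mul_gaussian_ne_zero_of_wigner_pos`). It is entire with growth `exp (K |z|²)`, so it is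
the exponential of a quadratic polynomial, whose coefficients are given by its first two
derivatives at the origin (`Complex.eq_mul_exp_quadratic_of_growth`). Those derivatives are the
first and second moments of `g`, a linear and a quadratic form in `w`; hence the Fourier transform of
`g` is a generalized Gaussian on all of `ℝᵈ`, without any function theory in several variables
(`exists_fourier_mul_gaussian_eq_gaussianFun`). The Riemann-Lebesgue lemma makes the real part of
its quadratic form definite, Fourier inversion gives `g`, and finally `f ∈ L²` forces definiteness of
the real part of the form of `f` (`posDef_map_re_of_memLp`).
-/

/-! ### Zero-free entire functions of Gaussian growth -/

/-- A logarithm is a primitive of the logarithmic derivative, which exists on all of `ℂ`. -/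
theorem Complex.exists_exp_eq_of_differentiable_of_ne_zero {G : ℂ → ℂ} (hG : Differentiable ℂ G)
    (h0 : ∀ z, G z ≠ 0) :
    ∃ h : ℂ → ℂ, Differentiable ℂ h ∧ ∀ z, G z = Complex.exp (h z) := by
  have hd : Differentiable ℂ (fun z => deriv G z / G z) := by
    have h1 : Differentiable ℂ (deriv G) := fun z => (hG.analyticAt z).deriv.differentiableAt
    exact fun z => (h1 z).div (hG z) (h0 z)
  obtain ⟨h, hh⟩ := hd.isExactOn_univ.with_val_at 0 (Complex.log (G 0))
  have hder : ∀ z, HasDerivAt h (deriv G z / G z) z := fun z => hh.2 z (Set.mem_univ z)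
  refine ⟨h, fun z => (hder z).differentiableAt, ?_⟩
  have key : ∀ z, HasDerivAt (fun z => G z * Complex.exp (-h z)) 0 z := by
    intro z
    have := (hG z).hasDerivAt.mul (hder z).neg.cexp
    convert! this using 1
    field_simp [h0 z]
    ring
  have hconst : ∀ z, G z * Complex.exp (-h z) = 1 := by
    intro z
    rw [is_const_of_deriv_eq_zero (fun z => (key z).differentiableAt) (fun z => (key z).deriv) z 0,
      hh.1, Complex.exp_neg, Complex.exp_log (h0 0), mul_inv_cancel₀ (h0 0)]
  intro z
  have := hconst z
  rw [Complex.exp_neg, ← div_eq_mul_inv, div_eq_one_iff_eq (Complex.exp_ne_zero _)] at this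
  exact this

/-- Liouville's theorem for entire functions whose real part grows at most quadratically:
Borel-Carathéodory bounds the function itself, and Cauchy's estimate kills its third derivative. -/
theorem Complex.eq_quadratic_of_re_le {h : ℂ → ℂ} (hh : Differentiable ℂ h) {C K : ℝ}
    (hle : ∀ z, (h z).re ≤ C + K * ‖z‖ ^ 2) :
    ∃ α β : ℂ, ∀ z, h z = h 0 + α * z + β * z ^ 2 := by
  -- Borel-Carathéodory on the disc of radius `2 * R`, evaluated on the circle of radius `R`.
  have hbd : ∀ R : ℝ, 0 < R → ∀ z ∈ Metric.ball (0 : ℂ) (2 * R), ‖z‖ = R →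
      ‖h z‖ ≤ 2 * (|C| + |K| * (2 * R) ^ 2 + 1) + 3 * ‖h 0‖ := by
    intro R hR z hz hzR
    have := Complex.borelCaratheodory (f := h) (R := 2 * R) (M := |C| + |K| * (2 * R) ^ 2 + 1)
      (z := z) (by positivity) hh.differentiableOn ?_ (by positivity) hz
    · refine this.trans (le_of_eq ?_)
      rw [hzR]
      field_simp
      ring
    · intro w hw
      have hw' : ‖w‖ < 2 * R := by simpa using hw
      have h1 : K * ‖w‖ ^ 2 ≤ |K| * (2 * R) ^ 2 := by
        have : ‖w‖ ^ 2 ≤ (2 * R) ^ 2 := by gcongr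
        exact mul_le_mul (le_abs_self K) this (by positivity) (abs_nonneg K)
      have := hle w
      have := le_abs_self C
      simp only [Set.mem_ofPred_eq]
      linarith
  have hn : ∀ n : ℕ, 3 ≤ n → iteratedDeriv n h 0 = 0 := by
    intro n hn3
    rw [← norm_le_zero_iff]
    have hlim : Filter.Tendsto
        (fun R : ℝ => (n.factorial * (2 * (|C| + 4 * |K| + 1) + 3 * ‖h 0‖)) * R⁻¹)
        Filter.atTop (nhds 0) := by
      simpa using tendsto_inv_atTop_zero.const_mul
        (n.factorial * (2 * (|C| + 4 * |K| + 1) + 3 * ‖h 0‖) : ℝ)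
    refine ge_of_tendsto hlim ?_
    filter_upwards [Filter.eventually_ge_atTop (1 : ℝ)] with R hR
    have hR0 : 0 < R := by linarith
    refine (Complex.norm_iteratedDeriv_le_of_forall_mem_sphere_norm_le n hR0 hh.diffContOnCl
      (C := (2 * (|C| + 4 * |K| + 1) + 3 * ‖h 0‖) * R ^ 2) ?_).trans ?_
    · intro z hz
      have hz' : ‖z‖ = R := by simpa using hz
      refine (hbd R hR0 z (by simp [hz']; linarith) hz').trans ?_
      have h1 : 1 ≤ R ^ 2 := one_le_pow₀ hR
      nlinarith [abs_nonneg C, norm_nonneg (h 0),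
        mul_nonneg (abs_nonneg C) (sub_nonneg.2 h1), mul_nonneg (norm_nonneg (h 0)) (sub_nonneg.2 h1)]
    · have h3 : R ^ 3 ≤ R ^ n := pow_le_pow_right₀ hR hn3
      calc _ ≤ n.factorial * ((2 * (|C| + 4 * |K| + 1) + 3 * ‖h 0‖) * R ^ 2) / R ^ 3 := by gcongr
        _ = _ := by field_simp
  refine ⟨iteratedDeriv 1 h 0, (2 : ℂ)⁻¹ * iteratedDeriv 2 h 0, fun z => ?_⟩
  rw [← Complex.taylorSeries_eq_of_entire' 0 z hh, tsum_eq_sum (s := Finset.range 3)]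
  · simp [Finset.sum_range_succ, Nat.factorial]
  · intro n hn'
    rw [hn n (by simpa using hn')]
    simp

/-- An entire function without zeros of Gaussian growth is a Gaussian, whose exponent is read off
from the first two derivatives at the origin. -/
theorem Complex.eq_mul_exp_quadratic_of_growth {G G₁ : ℂ → ℂ} {m : ℂ}
    (hG : ∀ z, HasDerivAt G (G₁ z) z) (hG₁ : HasDerivAt G₁ m 0) (h0 : ∀ z, G z ≠ 0) {C K : ℝ}
    (hC : 0 < C) (hle : ∀ z, ‖G z‖ ≤ C * Real.exp (K * ‖z‖ ^ 2)) (z : ℂ) :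
    G z = G 0 * Complex.exp (G₁ 0 / G 0 * z + (m / G 0 - (G₁ 0 / G 0) ^ 2) / 2 * z ^ 2) := by
  obtain ⟨h, hh, hGh⟩ :=
    Complex.exists_exp_eq_of_differentiable_of_ne_zero (fun z => (hG z).differentiableAt) h0
  obtain ⟨α, β, hq⟩ := Complex.eq_quadratic_of_re_le hh (C := Real.log C) (K := K) (fun z => by
    have := hle z
    rw [hGh, Complex.norm_exp] at this
    rw [← Real.exp_le_exp, Real.exp_add, Real.exp_log hC]
    exact this)
  have hform : ∀ z, G z = G 0 * Complex.exp (α * z + β * z ^ 2) := fun z => by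
    rw [hGh z, hGh 0, ← Complex.exp_add, hq z]
    ring_nf
  have hqd : ∀ z, HasDerivAt (fun z : ℂ => α * z + β * z ^ 2) (α + β * (2 * z)) z := fun z => by
    have := ((hasDerivAt_id z).const_mul α).add (((hasDerivAt_id z).pow 2).const_mul β)
    convert! this using 1
    simp
  have hG₁eq : G₁ = fun z => G z * (α + β * (2 * z)) := by
    funext z
    have h1 : HasDerivAt G (G 0 * (Complex.exp (α * z + β * z ^ 2) * (α + β * (2 * z)))) z := by
      have := (hqd z).cexp.const_mul (G 0)
      exact this.congr_of_eventuallyEq (Filter.Eventually.of_forall hform)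
    rw [(hG z).unique h1, hform z]
    ring
  have hα : G₁ 0 = G 0 * α := by simp [hG₁eq]
  have hm : m = G 0 * α * α + G 0 * (2 * β) := by
    have h2 : HasDerivAt (fun z : ℂ => α + β * (2 * z)) (2 * β) 0 := by
      have := ((((hasDerivAt_id (0 : ℂ)).const_mul 2).const_mul β)).const_add α
      convert! this using 1
      ring
    have h1 := (hG 0).mul h2
    have h3 := hG₁
    rw [hG₁eq] at h3
    rw [h3.unique h1, hα]
    simp
  rw [hform z, hm, hα]
  have := h0 0
  congr 2
  field_simp
  ring

/-! ### Laplace transforms of rapidly decaying functions -/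

section ExponentialMoments

variable {α : Type*} [MeasurableSpace α] {μ : Measure α} {g : α → ℂ} {X : α → ℝ}

theorem aestronglyMeasurable_of_integrable_mul_exp
    (hg : ∀ K : ℝ, Integrable (fun t => g t * (Real.exp (K * |X t|) : ℂ)) μ) :
    AEStronglyMeasurable g μ := by
  simpa using (hg 0).aestronglyMeasurable

/-- Exponential moments of all orders are inherited by `g * X`, so that
`hasDerivAt_integral_mul_cexp` can be applied repeatedly. -/
theorem integrable_mul_mul_exp (hX : AEMeasurable X μ)
    (hg : ∀ K : ℝ, Integrable (fun t => g t * (Real.exp (K * |X t|) : ℂ)) μ) (K : ℝ) :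
    Integrable (fun t => g t * X t * (Real.exp (K * |X t|) : ℂ)) μ := by
  have hgm := aestronglyMeasurable_of_integrable_mul_exp hg
  refine (hg (K + 1)).mono (by fun_prop) (Filter.Eventually.of_forall fun t => ?_)
  simp only [norm_mul, Complex.norm_real, Real.norm_eq_abs, Real.abs_exp, add_mul, one_mul,
    Real.exp_add]
  have : |X t| ≤ Real.exp |X t| := by linarith [Real.add_one_le_exp |X t|]
  nlinarith [mul_le_mul_of_nonneg_left this
    (mul_nonneg (norm_nonneg (g t)) (Real.exp_pos (K * |X t|)).le)]

/-- Differentiation under the integral sign for a complex-weighted moment generating function. -/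
theorem hasDerivAt_integral_mul_cexp (hX : AEMeasurable X μ)
    (hg : ∀ K : ℝ, Integrable (fun t => g t * (Real.exp (K * |X t|) : ℂ)) μ) (z : ℂ) :
    HasDerivAt (fun z : ℂ => ∫ t, g t * Complex.exp (z * X t) ∂μ)
      (∫ t, g t * X t * Complex.exp (z * X t) ∂μ) z := by
  have hgm := aestronglyMeasurable_of_integrable_mul_exp hg
  have hexp : ∀ (w : ℂ) (K : ℝ), ‖w‖ ≤ K → ∀ t,
      ‖Complex.exp (w * X t)‖ ≤ Real.exp (K * |X t|) := by
    intro w K hw t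
    rw [Complex.norm_exp, Real.exp_le_exp]
    refine (Complex.re_le_norm _).trans ?_
    rw [norm_mul, Complex.norm_real, Real.norm_eq_abs]
    gcongr
  refine (hasDerivAt_integral_of_dominated_loc_of_deriv_le (s := Metric.ball z 1)
    (F := fun (w : ℂ) t => g t * Complex.exp (w * X t))
    (F' := fun (w : ℂ) t => g t * X t * Complex.exp (w * X t))
    (bound := fun t => ‖g t * X t * (Real.exp ((‖z‖ + 1) * |X t|) : ℂ)‖)
    (Metric.ball_mem_nhds z one_pos) ?_ ?_ ?_ ?_ ?_ ?_).2
  · exact Filter.Eventually.of_forall fun w => by fun_prop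
  · refine (hg ‖z‖).mono (by fun_prop) (Filter.Eventually.of_forall fun t => ?_)
    rw [norm_mul, norm_mul, Complex.norm_real, Real.norm_eq_abs, Real.abs_exp]
    gcongr
    exact hexp z _ le_rfl t
  · fun_prop
  · refine Filter.Eventually.of_forall fun t w hw => ?_
    rw [norm_mul, norm_mul _ ((Real.exp _ : ℝ) : ℂ), Complex.norm_real, Real.norm_eq_abs,
      Real.abs_exp]
    gcongr
    refine hexp w _ ?_ t
    have h1 : ‖w - z‖ < 1 := by simpa [dist_eq_norm] using hw
    linarith [norm_le_norm_add_norm_sub' w z]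
  · exact (integrable_mul_mul_exp hX hg _).norm
  · refine Filter.Eventually.of_forall fun t w _ => ?_
    have := (((hasDerivAt_id w).mul_const (X t : ℂ)).cexp).const_mul (g t)
    convert! this using 1
    simp only [id_eq]
    ring

end ExponentialMoments

section GaussianWeight

variable {V : Type*} [NormedAddCommGroup V] [InnerProductSpace ℝ V] [FiniteDimensional ℝ V]
  [MeasurableSpace V] [BorelSpace V] {f : V → ℂ}

theorem MeasureTheory.MemLp.integrable_mul_gaussian (hf : MemLp f 2 volume) {c : ℝ} (hc : 0 < c) :
    Integrable (fun t => f t * (Real.exp (-c * ‖t‖ ^ 2) : ℂ)) volume := by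
  suffices h2 : MemLp (fun t : V => (Real.exp (-c * ‖t‖ ^ 2) : ℂ)) 2 volume from
    hf.integrable_mul h2
  rw [memLp_two_iff_integrable_sq_norm (by fun_prop)]
  have h := GaussianFourier.integrable_cexp_neg_mul_sq_norm_add (V := V) (b := (2 * c : ℝ))
    (by simpa using hc) 0 0
  refine h.norm.congr (Filter.Eventually.of_forall fun t => ?_)
  simp only [Complex.norm_exp, Complex.norm_real, Real.norm_eq_abs, Real.abs_exp, ← Real.exp_nat_mul]
  norm_cast
  simp
  ring

/-- Completing the square: half of the Gaussian weight absorbs an exponential, at the cost of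
`exp (w² k² / 2π)`. -/
theorem neg_pi_mul_sq_add_le (k w s : ℝ) :
    -Real.pi * s ^ 2 + k * (w * s) ≤
      -(Real.pi / 2) * s ^ 2 + w ^ 2 / (2 * Real.pi) * k ^ 2 := by
  have h : 0 ≤ (Real.pi * s - k * w) ^ 2 / (2 * Real.pi) := by positivity
  have h2 : (Real.pi * s - k * w) ^ 2 / (2 * Real.pi) =
      Real.pi / 2 * s ^ 2 - k * (w * s) + w ^ 2 / (2 * Real.pi) * k ^ 2 := by
    field_simp
    ring
  linarith

omit [FiniteDimensional ℝ V] [MeasurableSpace V] [BorelSpace V] in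
theorem norm_gaussian_mul_exp_le (f : V → ℂ) (w t : V) {k : ℝ} (hk : 0 ≤ k) :
    ‖f t * (Real.exp (-Real.pi * ‖t‖ ^ 2) : ℂ)‖ * Real.exp (k * |inner ℝ w t|) ≤
      Real.exp (‖w‖ ^ 2 / (2 * Real.pi) * k ^ 2) *
        ‖f t * (Real.exp (-(Real.pi / 2) * ‖t‖ ^ 2) : ℂ)‖ := by
  simp only [norm_mul, Complex.norm_real, Real.norm_eq_abs, Real.abs_exp]
  rw [mul_assoc, ← Real.exp_add, mul_left_comm (Real.exp (_ * k ^ 2)),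
    ← Real.exp_add]
  refine mul_le_mul_of_nonneg_left (Real.exp_le_exp.2 ?_) (norm_nonneg _)
  have h1 : k * |inner ℝ w t| ≤ k * (‖w‖ * ‖t‖) := by
    gcongr
    exact abs_real_inner_le_norm w t
  linarith [neg_pi_mul_sq_add_le k ‖w‖ ‖t‖]

theorem MeasureTheory.MemLp.integrable_gaussian_mul_exp (hf : MemLp f 2 volume) (w : V) (K : ℝ) :
    Integrable (fun t => f t * (Real.exp (-Real.pi * ‖t‖ ^ 2) : ℂ) *
      (Real.exp (K * |inner ℝ w t|) : ℂ)) volume := by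
  have hfm := hf.aestronglyMeasurable
  refine ((hf.integrable_mul_gaussian (c := Real.pi / 2) (by positivity)).norm.const_mul
    (Real.exp (‖w‖ ^ 2 / (2 * Real.pi) * |K| ^ 2))).mono' (by fun_prop)
    (Filter.Eventually.of_forall fun t => ?_)
  refine le_trans ?_ (norm_gaussian_mul_exp_le f w t (abs_nonneg K))
  rw [norm_mul, Complex.norm_real, Real.norm_eq_abs, Real.abs_exp]
  gcongr
  exact le_abs_self K

/-- The Laplace transform of `f` times a Gaussian has order at most two. -/
theorem MeasureTheory.MemLp.norm_integral_gaussian_mul_cexp_le (hf : MemLp f 2 volume) (w : V)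
    (z : ℂ) :
    ‖∫ t, f t * (Real.exp (-Real.pi * ‖t‖ ^ 2) : ℂ) * Complex.exp (z * (inner ℝ w t : ℝ))‖ ≤
      (∫ t, ‖f t * (Real.exp (-(Real.pi / 2) * ‖t‖ ^ 2) : ℂ)‖) *
        Real.exp (‖w‖ ^ 2 / (2 * Real.pi) * ‖z‖ ^ 2) := by
  rw [mul_comm, ← integral_const_mul]
  refine norm_integral_le_of_norm_le
    ((hf.integrable_mul_gaussian (c := Real.pi / 2) (by positivity)).norm.const_mul _)
    (Filter.Eventually.of_forall fun t => ?_)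
  refine le_trans ?_ (norm_gaussian_mul_exp_le f w t (norm_nonneg z))
  rw [norm_mul]
  gcongr
  rw [Complex.norm_exp, Real.exp_le_exp]
  refine (Complex.re_le_norm _).trans (le_of_eq ?_)
  rw [norm_mul, Complex.norm_real, Real.norm_eq_abs]

end GaussianWeight

/-! ### Positivity of the Wigner distribution and Gaussians -/

theorem integral_complex_pos {α : Type*} [MeasurableSpace α] {μ : Measure α} [NeZero μ]
    {F : α → ℂ} (hF : Integrable F μ) (hpos : ∀ a, 0 < F a) : 0 < ∫ a, F a ∂μ := by
  have h : ∀ a, F a = ((F a).re : ℂ) := fun a => Complex.eq_re_of_ofReal_le (hpos a).le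
  rw [integral_congr_ae (Filter.Eventually.of_forall h), integral_complex_ofReal,
    Complex.zero_lt_real, integral_pos_iff_support_of_nonneg]
  · have : Function.support (fun a => (F a).re) = Set.univ := by
      ext a
      simpa using (Complex.pos_iff.1 (hpos a)).1.ne'
    rw [this]
    exact Measure.measure_univ_pos.2 (NeZero.ne μ)
  · exact fun a => (Complex.pos_iff.1 (hpos a)).1.le
  · exact hF.re

section

variable {V : Type*} [NormedAddCommGroup V] [InnerProductSpace ℝ V] [FiniteDimensional ℝ V]
  [MeasurableSpace V] [BorelSpace V]

/-- A positive Fourier transform has a positive integral against a translated Gaussian; by Fubini's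
theorem this is the integral of `φ` against a modulated Gaussian. The factor `(π / 2π) ^ (n / 2)` comes from the transform
of `exp (-2π ‖ω‖²)`. -/
theorem integral_mul_gaussian_pos_of_fourier_pos {φ : V → ℂ} (hφ : Integrable φ)
    (hpos : ∀ ω : V, 0 < ∫ t, φ t *
      Complex.exp (-2 * (Real.pi : ℂ) * Complex.I * ((inner ℝ ω t : ℝ) : ℂ))) (b : V) :
    0 < ((Real.pi : ℂ) / (2 * Real.pi)) ^ (Module.finrank ℝ V / 2 : ℂ) *
      ∫ t, φ t * (Complex.exp (Complex.I * (inner ℝ b t : ℝ)) *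
        Complex.exp (-(Real.pi / 2) * ‖t‖ ^ 2)) := by
  -- The integral over `ω` of `𝓕 φ (ω - c) * exp (-2π ‖ω‖²)`, with `c = b / 2π`, is positive.
  set c : V := (2 * Real.pi)⁻¹ • b with hc
  let k : V × V → ℂ := fun p =>
    φ p.1 * Complex.exp (-(2 * Real.pi : ℂ) * ‖p.2‖ ^ 2) *
      Complex.exp (-2 * (Real.pi : ℂ) * Complex.I * ((inner ℝ (p.2 - c) p.1 : ℝ) : ℂ))
  have hgauss : Integrable (fun ω : V => Complex.exp (-(2 * Real.pi : ℂ) * ‖ω‖ ^ 2)) := by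
    simpa using GaussianFourier.integrable_cexp_neg_mul_sq_norm_add (V := V)
      (b := (2 * Real.pi : ℂ)) (by simpa using Real.pi_pos) 0 0
  have hk : Integrable k (volume.prod volume) := by
    refine (hφ.mul_prod hgauss).mul_bdd (c := 1) (by fun_prop) ?_
    refine Filter.Eventually.of_forall fun p => le_of_eq ?_
    rw [Complex.norm_exp]
    simp
  have h1 : ∀ t, ∫ ω, k (t, ω) =
      ((Real.pi : ℂ) / (2 * Real.pi)) ^ (Module.finrank ℝ V / 2 : ℂ) *
        (φ t * (Complex.exp (Complex.I * (inner ℝ b t : ℝ)) *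
          Complex.exp (-(Real.pi / 2) * ‖t‖ ^ 2))) := by
    intro t
    have hfg := GaussianFourier.integral_cexp_neg_mul_sq_norm_add (V := V)
      (b := (2 * Real.pi : ℂ)) (by simpa using Real.pi_pos) (-2 * Real.pi * Complex.I) t
    have : ∀ ω, k (t, ω) = φ t * Complex.exp (Complex.I * (inner ℝ b t : ℝ)) *
        Complex.exp (-(2 * Real.pi : ℂ) * ‖ω‖ ^ 2 + -2 * Real.pi * Complex.I * (inner ℝ t ω : ℝ)) := by
      intro ω
      simp only [k, mul_assoc, ← Complex.exp_add]
      congr 2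
      rw [hc, inner_sub_left, inner_smul_left, real_inner_comm]
      push_cast
      simp only [conj_trivial]
      field_simp
      push_cast
      field_simp
      ring
    simp_rw [this]
    rw [integral_const_mul, hfg]
    have h2 : (-2 * (Real.pi : ℂ) * Complex.I) ^ 2 * ‖t‖ ^ 2 / (4 * (2 * Real.pi)) =
        -(Real.pi / 2) * ‖t‖ ^ 2 := by
      have : (Real.pi : ℂ) ≠ 0 := by exact_mod_cast Real.pi_ne_zero
      rw [mul_pow, Complex.I_sq]
      field_simp
      ring
    rw [h2]
    ring
  have h2 : ∀ ω, 0 < ∫ t, k (t, ω) := by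
    intro ω
    have : ∀ t, k (t, ω) = (Real.exp (-(2 * Real.pi) * ‖ω‖ ^ 2) : ℂ) * (φ t *
        Complex.exp (-2 * (Real.pi : ℂ) * Complex.I * ((inner ℝ (ω - c) t : ℝ) : ℂ))) := by
      intro t
      simp only [k]
      push_cast
      ring
    simp_rw [this]
    rw [integral_const_mul]
    exact mul_pos (Complex.zero_lt_real.2 (Real.exp_pos _)) (hpos _)
  rw [← integral_const_mul, ← integral_congr_ae (Filter.Eventually.of_forall h1),
    integral_integral_swap hk]
  exact integral_complex_pos hk.integral_prod_right h2

/-- The map `(x, t) ↦ (x + t/2, x - t/2)` scales Lebesgue measure. -/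
theorem exists_map_add_half_sub_half :
    ∃ (L : (V × V) ≃L[ℝ] (V × V)) (c : NNReal),
      (∀ p, L p = (p.1 + (1 / 2 : ℝ) • p.2, p.1 - (1 / 2 : ℝ) • p.2)) ∧
      Measure.map L (volume.prod volume) = c • (volume.prod volume : Measure (V × V)) := by
  let L₀ : (V × V) →ₗ[ℝ] (V × V) :=
    { toFun := fun p => (p.1 + (1 / 2 : ℝ) • p.2, p.1 - (1 / 2 : ℝ) • p.2)
      map_add' := fun p q => by ext <;> simp <;> module
      map_smul' := fun c p => by ext <;> simp <;> module }
  let L₁ : (V × V) →ₗ[ℝ] (V × V) :=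
    { toFun := fun p => ((1 / 2 : ℝ) • (p.1 + p.2), p.1 - p.2)
      map_add' := fun p q => by ext <;> simp <;> module
      map_smul' := fun c p => by ext <;> simp <;> module }
  let L : (V × V) ≃L[ℝ] (V × V) := LinearEquiv.toContinuousLinearEquiv
    (LinearEquiv.ofLinearMap L₀ L₁ (by ext <;> simp [L₀, L₁] <;> module)
      (by ext <;> simp [L₀, L₁] <;> module))
  have : (Measure.map L (volume.prod volume : Measure (V × V))).IsAddHaarMeasure :=
    L.isAddHaarMeasure_map _
  exact ⟨L, _, fun p => rfl, Measure.isAddLeftInvariant_eq_smul _ _⟩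

omit [FiniteDimensional ℝ V] [MeasurableSpace V] [BorelSpace V] in
/-- The parallelogram law in the coordinates `(x, t) ↦ (x + t/2, x - t/2)`. -/
theorem norm_add_half_sq_add_norm_sub_half_sq (x t : V) :
    ‖x + (1 / 2 : ℝ) • t‖ ^ 2 + ‖x - (1 / 2 : ℝ) • t‖ ^ 2 = 2 * ‖x‖ ^ 2 + ‖t‖ ^ 2 / 2 := by
  rw [norm_add_sq_real, norm_sub_sq_real, norm_smul, mul_pow]
  norm_num
  ring

end

/-- The Wigner distribution of a Gaussian is a Gaussian, so by Moyal's identity a function with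
positive Wigner distribution is not orthogonal to any translated and modulated Gaussian. -/
theorem integral_mul_gaussian_ne_zero_of_wigner_pos {d : ℕ} {f : EuclideanSpace ℝ (Fin d) → ℂ}
    (hf : MemLp f 2 volume) (hW : ∀ x ω, 0 < wigner f x ω) (w : EuclideanSpace ℝ (Fin d)) (z : ℂ) :
    ∫ t, f t * (Real.exp (-Real.pi * ‖t‖ ^ 2) : ℂ) * Complex.exp (z * (inner ℝ w t : ℝ)) ≠ 0 := by
  intro h0
  set H : EuclideanSpace ℝ (Fin d) → ℂ := fun t =>
    f t * (Real.exp (-Real.pi * ‖t‖ ^ 2) : ℂ) * Complex.exp (z * (inner ℝ w t : ℝ)) with hH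
  have hHint : Integrable H := by
    have hfm := hf.aestronglyMeasurable
    refine (hf.integrable_gaussian_mul_exp w ‖z‖).mono (by fun_prop)
      (Filter.Eventually.of_forall fun t => ?_)
    simp only [hH]
    rw [norm_mul, norm_mul _ ((Real.exp (‖z‖ * |inner ℝ w t|) : ℝ) : ℂ), Complex.norm_real, Real.norm_eq_abs,
      Real.abs_exp]
    gcongr
    rw [Complex.norm_exp, Real.exp_le_exp]
    refine (Complex.re_le_norm _).trans (le_of_eq ?_)
    rw [norm_mul, Complex.norm_real, Real.norm_eq_abs]
  -- If `∫ H = 0`, then `H u * conj (H v)` has integral `|∫ H|² = 0`; in the variables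
  -- `u = x + t/2`, `v = x - t/2` its integral over `t` is, up to a positive factor, an integral
  -- of `wigner f x` against a positive Gaussian.
  let K : EuclideanSpace ℝ (Fin d) × EuclideanSpace ℝ (Fin d) → ℂ :=
    fun p => H p.1 * (starRingEnd ℂ) (H p.2)
  have hHc : Integrable (fun t => (starRingEnd ℂ) (H t)) :=
    (LinearIsometryEquiv.integrable_comp_iff Complex.conjLIE).2 hHint
  have hK : Integrable K (volume.prod volume) := hHint.mul_prod hHc
  have hK0 : ∫ p, K p ∂(volume.prod volume) = 0 := by
    rw [integral_prod_mul H (fun t => (starRingEnd ℂ) (H t)), h0, zero_mul]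
  obtain ⟨L, c, hL, hmap⟩ := exists_map_add_half_sub_half (V := EuclideanSpace ℝ (Fin d))
  have hemb : MeasurableEmbedding L := L.toHomeomorph.measurableEmbedding
  have hKL : Integrable (fun p => K (L p)) (volume.prod volume) := by
    change Integrable (K ∘ L) _
    rw [← hemb.integrable_map_iff]
    rw [hmap]
    exact hK.smul_measure_nnreal
  have hKL0 : ∫ p, K (L p) ∂(volume.prod volume) = 0 := by
    rw [← hemb.integral_map, hmap, integral_smul_nnreal_measure, hK0, smul_zero]
  rw [integral_prod _ hKL] at hKL0
  set C : ℂ := ((Real.pi : ℂ) / (2 * Real.pi)) ^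
    (Module.finrank ℝ (EuclideanSpace ℝ (Fin d)) / 2 : ℂ)
  have hpos : ∀ x, 0 < C * ∫ t, K (L (x, t)) := by
    intro x
    set φ : EuclideanSpace ℝ (Fin d) → ℂ := fun t =>
      f (x + (1 / 2 : ℝ) • t) * (starRingEnd ℂ) (f (x - (1 / 2 : ℝ) • t)) with hφ
    -- A Bochner integral that is not zero is the integral of an integrable function.
    have hφi : Integrable φ := by
      by_contra hcon
      have h := hW x 0
      simp only [wigner, inner_zero_left, Complex.ofReal_zero, mul_zero, Complex.exp_zero,
        mul_one] at h
      rw [integral_undef hcon] at h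
      exact lt_irrefl _ h
    have hmain := integral_mul_gaussian_pos_of_fourier_pos hφi (hW x) (z.im • w)
    have hKx : ∀ t, K (L (x, t)) =
        (Real.exp (-2 * Real.pi * ‖x‖ ^ 2 + 2 * z.re * inner ℝ w x) : ℂ) *
        (φ t * (Complex.exp (Complex.I * (inner ℝ (z.im • w) t : ℝ)) *
          Complex.exp (-(Real.pi / 2) * ‖t‖ ^ 2))) := by
      intro t
      have hn := norm_add_half_sq_add_norm_sub_half_sq x t
      have hn' : ((‖x - (1 / 2 : ℝ) • t‖ : ℂ)) ^ 2 =
          2 * ‖x‖ ^ 2 + ‖t‖ ^ 2 / 2 - ‖x + (1 / 2 : ℝ) • t‖ ^ 2 := by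
        rw [← Complex.ofReal_pow, eq_sub_of_add_eq' hn]
        push_cast
        ring
      have hz : (starRingEnd ℂ) z = z.re - z.im * Complex.I := by
        apply Complex.ext <;> simp
      have hz' := Complex.re_add_im z
      rw [hL]
      simp only [K, hH, map_mul, ← Complex.exp_conj, Complex.conj_ofReal, Complex.ofReal_exp]
      have : ∀ a b c d e g : ℂ, a * b * c * (d * e * g) = (a * d) * (b * c * e * g) := by
        intros; ring
      rw [this]
      change φ t * _ = _
      rw [mul_left_comm _ (φ t)]
      simp only [← Complex.exp_add]
      congr 2
      simp only [inner_add_right, inner_sub_right, inner_smul_right, inner_smul_left]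
      push_cast
      rw [hn', hz]
      nth_rewrite 1 [← hz']
      simp only [conj_trivial]
      ring
    simp_rw [hKx]
    rw [integral_const_mul, mul_left_comm]
    exact mul_pos (Complex.zero_lt_real.2 (Real.exp_pos _)) hmain
  have hfin := integral_complex_pos (hKL.integral_prod_left.const_mul C) hpos
  rw [integral_const_mul, hKL0, mul_zero] at hfin
  exact lt_irrefl _ hfin

/-! ### Gaussian integrals with complex quadratic forms -/

/-- Two real quadratic forms, the first of them positive definite, are diagonalized by one
congruence: with `R = Yᵀ Y` and `U` an orthogonal matrix of eigenvectors of `Y⁻ᵀ T Y⁻¹`, the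
matrix `Y⁻¹ U` does it. -/
theorem Matrix.PosDef.exists_simultaneous_diagonalization {n : Type*} [Fintype n] [DecidableEq n]
    {R T : Matrix n n ℝ} (hR : R.PosDef) (hT : T.IsSymm) :
    ∃ (S : Matrix n n ℝ) (e : n → ℝ), S.det ≠ 0 ∧ Sᵀ * R * S = 1 ∧
      Sᵀ * T * S = Matrix.diagonal e := by
  obtain ⟨Y, hY⟩ : ∃ Y : Matrix n n ℝ, R = Yᵀ * Y := by
    open scoped MatrixOrder in
    obtain ⟨Y, hY⟩ := CStarAlgebra.nonneg_iff_eq_star_mul_self.mp hR.posSemidef.nonneg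
    exact ⟨Y, by rw [hY, Matrix.star_eq_conjTranspose, Matrix.conjTranspose_eq_transpose_of_trivial]⟩
  have hYdet : IsUnit Y.det := by
    have h := hR.det_pos.ne'
    rw [hY, Matrix.det_mul, Matrix.det_transpose] at h
    exact isUnit_iff_ne_zero.2 (left_ne_zero_of_mul h)
  have hT' : (Y⁻¹ᵀ * T * Y⁻¹).IsHermitian := by
    rw [Matrix.IsHermitian, Matrix.conjTranspose_eq_transpose_of_trivial, Matrix.transpose_mul,
      Matrix.transpose_mul, Matrix.transpose_transpose, hT.eq, Matrix.mul_assoc]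
  set U : Matrix n n ℝ := (hT'.eigenvectorUnitary : Matrix n n ℝ) with hU
  have hUU : Uᵀ * U = 1 := by
    have := Unitary.coe_star_mul_self hT'.eigenvectorUnitary
    rwa [Matrix.star_eq_conjTranspose, Matrix.conjTranspose_eq_transpose_of_trivial] at this
  have hdiag : Uᵀ * (Y⁻¹ᵀ * T * Y⁻¹) * U = Matrix.diagonal hT'.eigenvalues := by
    have := hT'.conjStarAlgAut_star_eigenvectorUnitary
    rw [Unitary.conjStarAlgAut_star_apply, Matrix.star_eq_conjTranspose,
      Matrix.conjTranspose_eq_transpose_of_trivial] at this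
    exact this
  have hUdet : U.det ≠ 0 := by
    intro h
    have := congrArg Matrix.det hUU
    simp [h] at this
  refine ⟨Y⁻¹ * U, hT'.eigenvalues, ?_, ?_, ?_⟩
  · rw [Matrix.det_mul, Matrix.det_nonsing_inv, Ring.inverse_eq_inv']
    exact mul_ne_zero (inv_ne_zero hYdet.ne_zero) hUdet
  · have h1 : Y⁻¹ᵀ * Yᵀ = 1 := by
      rw [← Matrix.transpose_mul, Matrix.mul_nonsing_inv _ hYdet, Matrix.transpose_one]
    have h2 : Y * Y⁻¹ = 1 := Matrix.mul_nonsing_inv _ hYdet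
    calc (Y⁻¹ * U)ᵀ * R * (Y⁻¹ * U) = Uᵀ * ((Y⁻¹ᵀ * Yᵀ) * (Y * Y⁻¹)) * U := by
          rw [hY, Matrix.transpose_mul]; simp only [Matrix.mul_assoc]
      _ = 1 := by rw [h1, h2, Matrix.mul_one, Matrix.mul_one, hUU]
  · rw [← hdiag, Matrix.transpose_mul]
    simp only [Matrix.mul_assoc]

section ChangeOfVariables

variable {d : ℕ} {S : Matrix (Fin d) (Fin d) ℝ}

theorem measurableEmbedding_toLp_mulVec (hS : S.det ≠ 0) :
    MeasurableEmbedding (fun s : Fin d → ℝ => (WithLp.toLp 2 (S *ᵥ s) : EuclideanSpace ℝ (Fin d))) := by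
  refine (MeasurableEquiv.toLp 2 (Fin d → ℝ)).measurableEmbedding.comp (g := WithLp.toLp 2)
    (Continuous.measurableEmbedding (f := fun s => S *ᵥ s) (by fun_prop) ?_)
  exact Matrix.mulVec_injective_iff_isUnit.2
    ((Matrix.isUnit_iff_isUnit_det S).2 (isUnit_iff_ne_zero.2 hS))

theorem map_toLp_mulVec_volume (hS : S.det ≠ 0) :
    Measure.map (fun s : Fin d → ℝ => (WithLp.toLp 2 (S *ᵥ s) : EuclideanSpace ℝ (Fin d))) volume =
      ENNReal.ofReal |S.det⁻¹| • volume := by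
  have h := Real.map_matrix_volume_pi_eq_smul_volume_pi hS
  have hm : Measurable (WithLp.toLp 2 : (Fin d → ℝ) → EuclideanSpace ℝ (Fin d)) :=
    (PiLp.volume_preserving_toLp (Fin d)).measurable
  have h2 : (fun s : Fin d → ℝ => (WithLp.toLp 2 (S *ᵥ s) : EuclideanSpace ℝ (Fin d))) =
      (WithLp.toLp 2) ∘ (Matrix.toLin' S) := by
    funext s
    simp
  rw [h2, ← Measure.map_map hm (by fun_prop), h, Measure.map_smul,
    (PiLp.volume_preserving_toLp (Fin d)).map_eq]

theorem integral_comp_toLp_mulVec (hS : S.det ≠ 0) (F : EuclideanSpace ℝ (Fin d) → ℂ) :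
    ∫ t, F t = (|S.det| : ℝ) * ∫ s : Fin d → ℝ, F (WithLp.toLp 2 (S *ᵥ s)) := by
  rw [← (measurableEmbedding_toLp_mulVec hS).integral_map, map_toLp_mulVec_volume hS,
    integral_smul_measure, ENNReal.toReal_ofReal (abs_nonneg _), Complex.real_smul, ← mul_assoc,
    ← Complex.ofReal_mul, ← abs_mul, mul_inv_cancel₀ hS]
  simp

theorem integrable_comp_toLp_mulVec_iff (hS : S.det ≠ 0) {F : EuclideanSpace ℝ (Fin d) → ℂ} :
    Integrable (fun s : Fin d → ℝ => F (WithLp.toLp 2 (S *ᵥ s))) ↔ Integrable F := by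
  change Integrable (F ∘ fun s : Fin d → ℝ => (WithLp.toLp 2 (S *ᵥ s) : EuclideanSpace ℝ (Fin d))) ↔ _
  rw [← (measurableEmbedding_toLp_mulVec hS).integrable_map_iff, map_toLp_mulVec_volume hS,
    integrable_smul_measure (by simpa using hS) ENNReal.ofReal_ne_top]

end ChangeOfVariables

section GaussianIntegral

variable {d : ℕ} {A : Matrix (Fin d) (Fin d) ℂ}

theorem Matrix.eq_map_re_add_map_im {m n : Type*} (A : Matrix m n ℂ) :
    A = (A.map Complex.re).map Complex.ofReal +
      Complex.I • (A.map Complex.im).map Complex.ofReal := by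
  ext i j
  simp [mul_comm Complex.I, Complex.re_add_im]

theorem complexVec_toLp_mulVec (S : Matrix (Fin d) (Fin d) ℝ) (s : Fin d → ℝ) :
    complexVec (WithLp.toLp 2 (S *ᵥ s)) = S.map Complex.ofReal *ᵥ fun i => (s i : ℂ) := by
  ext i
  simp [complexVec, Matrix.mulVec, dotProduct]

theorem transpose_map_mul_mul_map_eq_diagonal {S : Matrix (Fin d) (Fin d) ℝ} {e : Fin d → ℝ}
    (hSR : Sᵀ * A.map Complex.re * S = 1) (hST : Sᵀ * A.map Complex.im * S = Matrix.diagonal e) :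
    (S.map Complex.ofReal)ᵀ * A * S.map Complex.ofReal =
      Matrix.diagonal fun i => 1 + e i * Complex.I := by
  have hR' := congrArg (fun M : Matrix (Fin d) (Fin d) ℝ => M.map Complex.ofRealHom) hSR
  have hT' := congrArg (fun M : Matrix (Fin d) (Fin d) ℝ => M.map Complex.ofRealHom) hST
  simp only [Matrix.map_mul] at hR' hT'
  conv_lhs => rw [Matrix.eq_map_re_add_map_im A]
  rw [Matrix.mul_add, Matrix.add_mul, Matrix.mul_smul, Matrix.smul_mul]
  have hR'' : (S.map Complex.ofReal)ᵀ * (A.map Complex.re).map Complex.ofReal *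
    S.map Complex.ofReal = (1 : Matrix (Fin d) (Fin d) ℝ).map Complex.ofRealHom := hR'
  have hT'' : (S.map Complex.ofReal)ᵀ * (A.map Complex.im).map Complex.ofReal *
    S.map Complex.ofReal = (Matrix.diagonal e).map Complex.ofRealHom := hT'
  rw [hR'', hT'']
  ext i j
  by_cases hij : i = j
  · subst hij; simp [mul_comm]
  · simp [hij]

/-- In coordinates `t = S s` diagonalizing `A`, a Gaussian is a product of one-variable
Gaussians. -/
theorem gaussianFun_toLp_mulVec {S : Matrix (Fin d) (Fin d) ℝ} {e : Fin d → ℝ}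
    (hSR : Sᵀ * A.map Complex.re * S = 1) (hST : Sᵀ * A.map Complex.im * S = Matrix.diagonal e)
    (b : Fin d → ℂ) (c : ℂ) (s : Fin d → ℝ) :
    gaussianFun A b c (WithLp.toLp 2 (S *ᵥ s)) = Complex.exp c *
      Complex.exp (-∑ i, (Real.pi * (1 + e i * Complex.I)) * (s i : ℂ) ^ 2 +
        ∑ i, (2 * Real.pi * (b ᵥ* S.map Complex.ofReal) i) * s i) := by
  have hSA := transpose_map_mul_mul_map_eq_diagonal hSR hST
  rw [gaussianFun, complexVec_toLp_mulVec, ← Complex.exp_add]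
  congr 1
  have h1 : (S.map Complex.ofReal *ᵥ fun i => (s i : ℂ)) ⬝ᵥ
      (A *ᵥ (S.map Complex.ofReal *ᵥ fun i => (s i : ℂ))) =
      ∑ i, (1 + e i * Complex.I) * (s i : ℂ) ^ 2 := by
    rw [← Matrix.vecMul_transpose, ← Matrix.dotProduct_mulVec, Matrix.vecMul_transpose,
      Matrix.mulVec_mulVec, Matrix.mulVec_mulVec, hSA]
    simp only [dotProduct, Matrix.mulVec_diagonal]
    exact Finset.sum_congr rfl fun i _ => by ring
  rw [h1, Matrix.dotProduct_mulVec]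
  simp only [dotProduct, Finset.mul_sum, mul_assoc]
  rw [← Finset.sum_neg_distrib]
  simp only [neg_mul]
  ring

theorem one_add_ofReal_mul_I_ne_zero (x : ℝ) : (1 + x * Complex.I : ℂ) ≠ 0 := fun h => by
  simpa using congrArg Complex.re h

theorem re_pi_mul_one_add_pos (x : ℝ) : 0 < ((Real.pi : ℂ) * (1 + x * Complex.I)).re := by
  simpa using Real.pi_pos

theorem integrable_gaussianFun (hA : A.IsSymm) (hR : (A.map Complex.re).PosDef) (b : Fin d → ℂ)
    (c : ℂ) : Integrable (gaussianFun A b c) := by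
  obtain ⟨S, e, hS, hSR, hST⟩ := hR.exists_simultaneous_diagonalization (T := A.map Complex.im)
    (by rw [Matrix.IsSymm, ← Matrix.transpose_map, hA.eq])
  rw [← integrable_comp_toLp_mulVec_iff hS]
  simp_rw [gaussianFun_toLp_mulVec hSR hST]
  exact (GaussianFourier.integrable_cexp_neg_sum_mul_add
    (fun i => re_pi_mul_one_add_pos (e i)) _).const_mul _

/-- The integral of a generalized Gaussian. The matrix `M` is the inverse of `A`, although only
its symmetry matters here. For real `A` the constant `K` is positive and `M` is real. -/
theorem exists_integral_gaussianFun_eq (hA : A.IsSymm) (hR : (A.map Complex.re).PosDef) :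
    ∃ (M : Matrix (Fin d) (Fin d) ℂ) (K : ℂ), M.IsSymm ∧ K ≠ 0 ∧
      (∀ b c, ∫ t, gaussianFun A b c t = K * Complex.exp (c + Real.pi * (b ⬝ᵥ (M *ᵥ b)))) ∧
      (A.map Complex.im = 0 → 0 < K ∧ ∃ M' : Matrix (Fin d) (Fin d) ℝ, M = M'.map Complex.ofReal) := by
  obtain ⟨S, e, hS, hSR, hST⟩ := hR.exists_simultaneous_diagonalization (T := A.map Complex.im)
    (by rw [Matrix.IsSymm, ← Matrix.transpose_map, hA.eq])
  have hpi : (Real.pi : ℂ) ≠ 0 := by exact_mod_cast Real.pi_ne_zero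
  have hne : ∀ i, (1 + e i * Complex.I : ℂ) ≠ 0 := fun i =>
    one_add_ofReal_mul_I_ne_zero (e i)
  refine ⟨S.map Complex.ofReal * Matrix.diagonal (fun i => (1 + e i * Complex.I)⁻¹) *
      (S.map Complex.ofReal)ᵀ,
    (|S.det| : ℝ) * ∏ i, (Real.pi / (Real.pi * (1 + e i * Complex.I))) ^ (1 / 2 : ℂ), ?_, ?_, ?_, ?_⟩
  · rw [Matrix.IsSymm, Matrix.transpose_mul, Matrix.transpose_mul, Matrix.transpose_transpose,
      Matrix.diagonal_transpose, Matrix.mul_assoc]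
  · refine mul_ne_zero (by simpa using hS) (Finset.prod_ne_zero_iff.2 fun i _ => ?_)
    rw [Complex.cpow_ne_zero_iff]
    exact Or.inl (div_ne_zero hpi (mul_ne_zero hpi (hne i)))
  · intro b c
    rw [integral_comp_toLp_mulVec hS]
    simp_rw [gaussianFun_toLp_mulVec hSR hST]
    rw [integral_const_mul, GaussianFourier.integral_cexp_neg_sum_mul_add
      (fun i => re_pi_mul_one_add_pos (e i)), Finset.prod_mul_distrib, ← Complex.exp_sum,
      Complex.exp_add]
    have : ∑ i, (2 * Real.pi * (b ᵥ* S.map Complex.ofReal) i) ^ 2 /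
        (4 * (Real.pi * (1 + e i * Complex.I))) = Real.pi * (b ⬝ᵥ ((S.map Complex.ofReal *
          Matrix.diagonal (fun i => (1 + e i * Complex.I)⁻¹) * (S.map Complex.ofReal)ᵀ) *ᵥ b)) := by
      rw [← Matrix.mulVec_mulVec, Matrix.mulVec_transpose, Matrix.dotProduct_mulVec,
        ← Matrix.vecMul_vecMul]
      simp only [dotProduct, Matrix.vecMul_diagonal, Finset.mul_sum]
      refine Finset.sum_congr rfl fun i _ => ?_
      have := hne i
      field_simp
      ring
    rw [this]
    ring
  · intro him
    have he : e = 0 := by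
      rw [him, Matrix.mul_zero, Matrix.zero_mul, eq_comm, Matrix.diagonal_eq_zero] at hST
      exact hST
    subst he
    refine ⟨?_, S * Sᵀ, ?_⟩
    · simp only [Pi.zero_apply, Complex.ofReal_zero, zero_mul, add_zero, mul_one, div_self hpi,
        Complex.one_cpow, Finset.prod_const_one]
      exact Complex.zero_lt_real.2 (abs_pos.2 hS)
    · ext i j
      simp [Matrix.mul_apply]

theorem gaussianFun_sub_one (A : Matrix (Fin d) (Fin d) ℂ) (b : Fin d → ℂ) (c : ℂ)
    (t : EuclideanSpace ℝ (Fin d)) :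
    gaussianFun (A - 1) b c t = gaussianFun A b c t * (Real.exp (Real.pi * ‖t‖ ^ 2) : ℂ) := by
  have h : complexVec t ⬝ᵥ complexVec t = ((‖t‖ ^ 2 : ℝ) : ℂ) := by
    rw [EuclideanSpace.norm_sq_eq]
    simp [complexVec, dotProduct, sq]
  simp only [gaussianFun]
  rw [Complex.ofReal_exp, ← Complex.exp_add, Matrix.sub_mulVec, Matrix.one_mulVec, dotProduct_sub, h]
  congr 1
  push_cast
  ring

end GaussianIntegral

/-! ### Definiteness from decay or integrability -/

section Definiteness

variable {d : ℕ} {A : Matrix (Fin d) (Fin d) ℂ}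

theorem complexVec_add (s t : EuclideanSpace ℝ (Fin d)) :
    complexVec (s + t) = complexVec s + complexVec t := by
  ext i
  simp [complexVec]

theorem complexVec_sub (s t : EuclideanSpace ℝ (Fin d)) :
    complexVec (s - t) = complexVec s - complexVec t := by
  ext i
  simp [complexVec]

theorem re_complexVec_dotProduct_mulVec (A : Matrix (Fin d) (Fin d) ℂ)
    (u : EuclideanSpace ℝ (Fin d)) :
    (complexVec u ⬝ᵥ (A *ᵥ complexVec u)).re = u.ofLp ⬝ᵥ (A.map Complex.re *ᵥ u.ofLp) := by
  simp [complexVec, dotProduct, Matrix.mulVec]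

theorem continuous_gaussianFun (A : Matrix (Fin d) (Fin d) ℂ) (b : Fin d → ℂ) (c : ℂ) :
    Continuous (gaussianFun A b c) := by
  unfold gaussianFun complexVec
  simp only [dotProduct, Matrix.mulVec]
  fun_prop

theorem gaussianFun_add_mul_gaussianFun_sub (A : Matrix (Fin d) (Fin d) ℂ) (b : Fin d → ℂ) (c : ℂ)
    (t u : EuclideanSpace ℝ (Fin d)) :
    gaussianFun A b c (t + u) * gaussianFun A b c (t - u) =
      gaussianFun A b c t ^ 2 *
        Complex.exp (-2 * Real.pi * (complexVec u ⬝ᵥ (A *ᵥ complexVec u))) := by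
  simp only [gaussianFun]
  rw [← Complex.exp_add, ← Complex.exp_nat_mul, ← Complex.exp_add, complexVec_add, complexVec_sub]
  congr 1
  simp only [Matrix.mulVec_add, Matrix.mulVec_sub, dotProduct_add, dotProduct_sub, add_dotProduct,
    sub_dotProduct]
  push_cast
  ring

/-- Along a direction where the real part of the form is nonpositive, `log ‖gaussianFun A b c‖` is
midpoint convex. -/
theorem norm_gaussianFun_sq_le (b : Fin d → ℂ) (c : ℂ) {u : EuclideanSpace ℝ (Fin d)}
    (hu : u.ofLp ⬝ᵥ (A.map Complex.re *ᵥ u.ofLp) ≤ 0) (t : EuclideanSpace ℝ (Fin d)) :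
    ‖gaussianFun A b c t‖ ^ 2 ≤ ‖gaussianFun A b c (t + u)‖ * ‖gaussianFun A b c (t - u)‖ := by
  rw [← norm_mul, gaussianFun_add_mul_gaussianFun_sub, norm_mul, norm_pow, Complex.norm_exp]
  refine le_mul_of_one_le_right (by positivity) (Real.one_le_exp ?_)
  have h : (-2 * Real.pi * (complexVec u ⬝ᵥ (A *ᵥ complexVec u)) : ℂ).re =
      -2 * Real.pi * (complexVec u ⬝ᵥ (A *ᵥ complexVec u)).re := by
    rw [← Complex.re_ofReal_mul]
    push_cast
    rfl
  rw [h, re_complexVec_dotProduct_mulVec]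
  nlinarith [Real.pi_pos]

theorem smul_dotProduct_mulVec_smul_nonpos {R : Matrix (Fin d) (Fin d) ℝ}
    {u : EuclideanSpace ℝ (Fin d)} (hu : u.ofLp ⬝ᵥ (R *ᵥ u.ofLp) ≤ 0) (r : ℝ) :
    (r • u).ofLp ⬝ᵥ (R *ᵥ (r • u).ofLp) ≤ 0 := by
  rw [WithLp.ofLp_smul, Matrix.mulVec_smul, dotProduct_smul, smul_dotProduct, smul_smul, smul_eq_mul]
  exact mul_nonpos_of_nonneg_of_nonpos (mul_self_nonneg r) hu

theorem posDef_map_re_of_forall {A : Matrix (Fin d) (Fin d) ℂ} (hA : A.IsSymm)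
    (h : ∀ u : EuclideanSpace ℝ (Fin d), u ≠ 0 → ¬ u.ofLp ⬝ᵥ (A.map Complex.re *ᵥ u.ofLp) ≤ 0) :
    (A.map Complex.re).PosDef := by
  refine Matrix.PosDef.of_dotProduct_mulVec_pos ?_ fun x hx => ?_
  · rw [Matrix.IsHermitian, Matrix.conjTranspose_eq_transpose_of_trivial, ← Matrix.transpose_map,
      hA.eq]
  · simpa using h (WithLp.toLp 2 x) (by simpa using hx)

theorem tendsto_natCast_smul_cocompact {V : Type*} [NormedAddCommGroup V] [NormedSpace ℝ V]
    [ProperSpace V] {u : V} (hu : u ≠ 0) :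
    Filter.Tendsto (fun n : ℕ => (n : ℝ) • u) Filter.atTop (Filter.cocompact V) := by
  rw [← Metric.cobounded_eq_cocompact, ← tendsto_norm_atTop_iff_cobounded]
  simp only [norm_smul, Real.norm_natCast]
  exact tendsto_natCast_atTop_atTop.atTop_mul_const (norm_pos_iff.2 hu)

/-- A generalized Gaussian that vanishes at infinity has a quadratic form with positive definite
real part. -/
theorem posDef_map_re_of_tendsto_zero (hA : A.IsSymm) {b : Fin d → ℂ} {c : ℂ}
    (h : Filter.Tendsto (gaussianFun A b c) (Filter.cocompact _) (nhds 0)) :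
    (A.map Complex.re).PosDef := by
  refine posDef_map_re_of_forall hA fun u hu hneg => ?_
  have h1 := (h.comp (tendsto_natCast_smul_cocompact hu)).norm
  have h2 := (h.comp (tendsto_natCast_smul_cocompact (neg_ne_zero.2 hu))).norm
  have h3 := h1.mul h2
  simp only [norm_zero, mul_zero] at h3
  have h4 : ‖gaussianFun A b c 0‖ ^ 2 ≤ 0 := by
    refine ge_of_tendsto h3 (Filter.Eventually.of_forall fun n => ?_)
    have := norm_gaussianFun_sq_le b c (smul_dotProduct_mulVec_smul_nonpos hneg n) 0
    simpa using this
  have h5 : 0 < ‖gaussianFun A b c 0‖ := norm_pos_iff.2 (Complex.exp_ne_zero _)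
  nlinarith

/-- The mass of an integrable function on a unit ball vanishes as the ball moves to infinity. -/
theorem tendsto_setIntegral_ball_comp_add_smul {V : Type*} [NormedAddCommGroup V]
    [InnerProductSpace ℝ V] [FiniteDimensional ℝ V] [MeasurableSpace V] [BorelSpace V] {h : V → ℝ}
    (hh : Integrable h) {u : V} (hu : u ≠ 0) :
    Filter.Tendsto (fun n : ℕ => ∫ t in Metric.ball (0 : V) 1, h (t + (n : ℝ) • u)) Filter.atTop
      (nhds 0) := by
  have heq : ∀ n : ℕ, ∫ t in Metric.ball (0 : V) 1, h (t + (n : ℝ) • u) =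
      ∫ t, (Metric.ball ((n : ℝ) • u) 1).indicator h t := by
    intro n
    rw [← integral_indicator Metric.isOpen_ball.measurableSet,
      ← integral_add_right_eq_self ((Metric.ball ((n : ℝ) • u) 1).indicator h) ((n : ℝ) • u)]
    congr 1
    funext t
    simp [Set.indicator, dist_eq_norm]
  simp_rw [heq]
  rw [show (0 : ℝ) = ∫ _ : V, (0 : ℝ) by simp]
  refine tendsto_integral_of_dominated_convergence (fun t => ‖h t‖)
    (fun n => hh.aestronglyMeasurable.indicator Metric.isOpen_ball.measurableSet) hh.norm
    (fun n => Filter.Eventually.of_forall fun t => norm_indicator_le_norm_self _ _)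
    (Filter.Eventually.of_forall fun t => ?_)
  refine tendsto_const_nhds.congr' ?_
  have h1 := (tendsto_natCast_smul_cocompact hu).eventually
    (isCompact_closedBall t 1).compl_mem_cocompact
  filter_upwards [h1] with n hn
  rw [Set.indicator_of_notMem]
  intro hmem
  apply hn
  rw [Metric.mem_closedBall, dist_comm]
  exact (Metric.mem_ball.1 hmem).le

/-- A square-integrable generalized Gaussian has a quadratic form with positive definite real part:
along a direction where the form is nonpositive, the mass over translates of a ball cannot decay. -/
theorem posDef_map_re_of_memLp (hA : A.IsSymm) {b : Fin d → ℂ} {c : ℂ}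
    (h : MemLp (gaussianFun A b c) 2 volume) : (A.map Complex.re).PosDef := by
  refine posDef_map_re_of_forall hA fun u hu hneg => ?_
  have hc : Continuous (fun t => ‖gaussianFun A b c t‖ ^ 2) :=
    (continuous_gaussianFun A b c).norm.pow 2
  have hint : Integrable (fun t => ‖gaussianFun A b c t‖ ^ 2) :=
    (memLp_two_iff_integrable_sq_norm h.1).1 h
  have hpos : 0 < ∫ t in Metric.ball (0 : EuclideanSpace ℝ (Fin d)) 1, ‖gaussianFun A b c t‖ ^ 2 := by
    refine (setIntegral_pos_iff_support_of_nonneg_ae ?_ hint.integrableOn).2 ?_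
    · exact Filter.Eventually.of_forall fun t => by positivity
    · have : Function.support (fun t => ‖gaussianFun A b c t‖ ^ 2) = Set.univ := by
        ext t
        simp [gaussianFun, Complex.exp_ne_zero]
      rw [this, Set.univ_inter]
      exact Metric.measure_ball_pos _ _ one_pos
  have h3 := (tendsto_setIntegral_ball_comp_add_smul hint hu).add
    (tendsto_setIntegral_ball_comp_add_smul hint (neg_ne_zero.2 hu))
  rw [add_zero] at h3
  have h4 : 2 * ∫ t in Metric.ball (0 : EuclideanSpace ℝ (Fin d)) 1, ‖gaussianFun A b c t‖ ^ 2 ≤ 0 := by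
    refine ge_of_tendsto h3 (Filter.Eventually.of_forall fun n => ?_)
    rw [← integral_add (hint.comp_add_right _).integrableOn (hint.comp_add_right _).integrableOn,
      ← integral_const_mul]
    refine integral_mono (hint.integrableOn.const_mul 2)
      ((hint.comp_add_right _).integrableOn.add (hint.comp_add_right _).integrableOn) fun t => ?_
    have := norm_gaussianFun_sq_le b c (smul_dotProduct_mulVec_smul_nonpos hneg n) t
    simp only [smul_neg, ← sub_eq_add_neg]
    nlinarith [sq_nonneg (‖gaussianFun A b c (t + (n : ℝ) • u)‖ -
      ‖gaussianFun A b c (t - (n : ℝ) • u)‖)]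
  linarith

/-- In diagonalizing coordinates the matrix has the nonzero diagonal entries `1 + e i * I`. -/
theorem isUnit_of_posDef_map_re (hA : A.IsSymm) (hR : (A.map Complex.re).PosDef) : IsUnit A := by
  obtain ⟨S, e, hS, hSR, hST⟩ := hR.exists_simultaneous_diagonalization (T := A.map Complex.im)
    (by rw [Matrix.IsSymm, ← Matrix.transpose_map, hA.eq])
  have h := congrArg Matrix.det (transpose_map_mul_mul_map_eq_diagonal hSR hST)
  rw [Matrix.det_mul, Matrix.det_mul, Matrix.det_diagonal] at h
  have hne : ∏ i, (1 + e i * Complex.I : ℂ) ≠ 0 :=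
    Finset.prod_ne_zero_iff.2 fun i _ => one_add_ofReal_mul_I_ne_zero (e i)
  rw [← h] at hne
  exact (Matrix.isUnit_iff_isUnit_det A).2
    (isUnit_iff_ne_zero.2 (right_ne_zero_of_mul (left_ne_zero_of_mul hne)))

end Definiteness

/-! ### Fourier inversion and the two implications -/

open scoped FourierTransform ContDiff in
/-- Fourier inversion almost everywhere, for an integrable function that need not be continuous:
both sides have the same integral against every test function. -/
theorem MeasureTheory.Integrable.ae_eq_fourierInv_fourier {V : Type*} [NormedAddCommGroup V]
    [InnerProductSpace ℝ V] [FiniteDimensional ℝ V] [MeasurableSpace V] [BorelSpace V] {g : V → ℂ}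
    (hg : Integrable g) (hG : Integrable (𝓕 g)) : g =ᵐ[volume] 𝓕⁻ (𝓕 g) := by
  have hBneg : Continuous fun p : V × V => (-innerₗ V) p.1 p.2 := continuous_inner.neg
  have hcont : Continuous (𝓕⁻ (𝓕 g)) := by
    have := VectorFourier.fourierIntegral_continuous Real.continuous_fourierChar hBneg hG
    exact this
  refine ae_eq_of_integral_contDiff_smul_eq hg.locallyIntegrable hcont.locallyIntegrable
    fun φ hφ hsupp => ?_
  have hs₁ : HasCompactSupport (Complex.ofRealCLM ∘ φ) := hsupp.comp_left rfl
  have hs₂ : ContDiff ℝ ∞ (Complex.ofRealCLM ∘ φ) := by fun_prop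
  set ψ : SchwartzMap V ℂ := hs₁.toSchwartzMap hs₂ with hψ
  have hψφ : ∀ x, ψ x = φ x := fun x => rfl
  have h1 : ∀ F : V → ℂ, ∫ x, φ x • F x = ∫ x, ψ x • F x := fun F => by
    simp [hψφ]
  have h2 : ∫ x, (𝓕 (𝓕⁻ ψ : SchwartzMap V ℂ) : SchwartzMap V ℂ) x • g x =
      ∫ x, (𝓕⁻ ψ : SchwartzMap V ℂ) x • (𝓕 g) x := by
    have := VectorFourier.integral_fourierIntegral_smul_eq_flip (L := innerₗ V)
      Real.continuous_fourierChar continuous_inner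
      ((𝓕⁻ ψ : SchwartzMap V ℂ).integrable (μ := volume)) hg
    rw [flip_innerₗ] at this
    rw [SchwartzMap.fourier_coe]
    exact this
  have h3 : ∫ x, (𝓕⁻ (ψ : V → ℂ)) x • (𝓕 g) x = ∫ x, ψ x • (𝓕⁻ (𝓕 g)) x := by
    have := VectorFourier.integral_fourierIntegral_smul_eq_flip (L := -innerₗ V)
      Real.continuous_fourierChar hBneg (ψ.integrable (μ := volume)) hG
    have hflip : (-innerₗ V).flip = -innerₗ V := by
      ext x y
      simp [real_inner_comm]
    rw [hflip] at this
    exact this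
  rw [h1, h1, ← h3, ← SchwartzMap.fourierInv_coe, ← h2, FourierTransform.fourier_fourierInv_eq]

section Hudson

variable {d : ℕ} {f : EuclideanSpace ℝ (Fin d) → ℂ}

theorem integral_mul_inner_eq_sum {g : EuclideanSpace ℝ (Fin d) → ℂ}
    (hg : ∀ j, Integrable (fun t => g t * (t j : ℂ))) (w : EuclideanSpace ℝ (Fin d)) :
    ∫ t, g t * (inner ℝ w t : ℝ) = ∑ j, (w j : ℂ) * ∫ t, g t * (t j : ℂ) := by
  simp_rw [← integral_const_mul]
  rw [← integral_finsetSum _ fun j _ => (hg j).const_mul _]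
  congr 1
  funext t
  simp only [PiLp.inner_apply, RCLike.inner_apply, conj_trivial]
  push_cast
  rw [Finset.mul_sum]
  exact Finset.sum_congr rfl fun j _ => by ring

theorem integral_mul_inner_sq_eq_sum {g : EuclideanSpace ℝ (Fin d) → ℂ}
    (hg : ∀ j k, Integrable (fun t => g t * (t j : ℂ) * (t k : ℂ))) (w : EuclideanSpace ℝ (Fin d)) :
    ∫ t, g t * (inner ℝ w t : ℝ) * (inner ℝ w t : ℝ) =
      ∑ j, ∑ k, (w j : ℂ) * (w k : ℂ) * ∫ t, g t * (t j : ℂ) * (t k : ℂ) := by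
  simp_rw [← integral_const_mul]
  have h1 : ∀ j, ∑ k, ∫ t, (w j : ℂ) * (w k : ℂ) * (g t * (t j : ℂ) * (t k : ℂ)) =
      ∫ t, ∑ k, (w j : ℂ) * (w k : ℂ) * (g t * (t j : ℂ) * (t k : ℂ)) := fun j =>
    (integral_finsetSum _ fun k _ => (hg j k).const_mul _).symm
  simp_rw [h1]
  rw [← integral_finsetSum _ fun j _ => integrable_finsetSum _ fun k _ => (hg j k).const_mul _]
  congr 1
  funext t
  simp only [PiLp.inner_apply, RCLike.inner_apply, conj_trivial]
  push_cast
  rw [mul_assoc, Finset.sum_mul_sum, Finset.mul_sum]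
  refine Finset.sum_congr rfl fun j _ => ?_
  rw [Finset.mul_sum]
  exact Finset.sum_congr rfl fun k _ => by ring

open scoped FourierTransform in
/-- If the Wigner distribution of `f` is positive, the Fourier transform of `f` times a Gaussian is
a generalized Gaussian: along each line it extends to a zero-free entire function of order two,
whose exponent is determined by the first two moments. -/
theorem exists_fourier_mul_gaussian_eq_gaussianFun (hf : MemLp f 2 volume)
    (hW : ∀ x ω, 0 < wigner f x ω) :
    ∃ (B : Matrix (Fin d) (Fin d) ℂ) (b : Fin d → ℂ) (c : ℂ), B.IsSymm ∧
      𝓕 (fun t => f t * (Real.exp (-Real.pi * ‖t‖ ^ 2) : ℂ)) = gaussianFun B b c := by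
  set g : EuclideanSpace ℝ (Fin d) → ℂ := fun t => f t * (Real.exp (-Real.pi * ‖t‖ ^ 2) : ℂ) with hg
  have hexp : ∀ (w : EuclideanSpace ℝ (Fin d)) (K : ℝ),
      Integrable (fun t => g t * (Real.exp (K * |inner ℝ w t|) : ℂ)) :=
    fun w K => hf.integrable_gaussian_mul_exp w K
  have hX : ∀ w : EuclideanSpace ℝ (Fin d), AEMeasurable (fun t => inner ℝ w t) volume :=
    fun w => by fun_prop
  have hgm : AEStronglyMeasurable g volume := aestronglyMeasurable_of_integrable_mul_exp (hexp 0)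
  have hcoord : ∀ (j : Fin d) (t : EuclideanSpace ℝ (Fin d)),
      inner ℝ (EuclideanSpace.single j (1 : ℝ)) t = t j := fun j t => by
    simp [EuclideanSpace.inner_single_left]
  have hm1 : ∀ j, Integrable (fun t => g t * (t j : ℂ)) := fun j => by
    simpa [hcoord] using integrable_mul_mul_exp (hX (EuclideanSpace.single j 1)) (hexp _) 0
  have hm2' : ∀ j, Integrable (fun t => g t * (t j : ℂ) * (t j : ℂ)) := fun j => by
    simpa [hcoord] using integrable_mul_mul_exp (hX (EuclideanSpace.single j 1))
      (integrable_mul_mul_exp (hX (EuclideanSpace.single j 1)) (hexp _)) 0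
  have hm2 : ∀ j k, Integrable (fun t => g t * (t j : ℂ) * (t k : ℂ)) := fun j k => by
    refine ((hm2' j).norm.add (hm2' k).norm).mono' (by fun_prop)
      (Filter.Eventually.of_forall fun t => ?_)
    simp only [norm_mul, Pi.add_apply]
    nlinarith [mul_nonneg (norm_nonneg (g t)) (sq_nonneg (‖(t j : ℂ)‖ - ‖(t k : ℂ)‖)),
      mul_nonneg (norm_nonneg (g t)) (sq_nonneg (‖(t j : ℂ)‖)),
      mul_nonneg (norm_nonneg (g t)) (sq_nonneg (‖(t k : ℂ)‖))]
  have hne : ∀ w z, ∫ t, g t * Complex.exp (z * (inner ℝ w t : ℝ)) ≠ 0 :=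
    integral_mul_gaussian_ne_zero_of_wigner_pos hf hW
  set N : ℂ := ∫ t, g t with hN
  have hN0 : N ≠ 0 := by simpa using hne 0 0
  set m : Fin d → ℂ := fun j => ∫ t, g t * (t j : ℂ) with hm
  have hline : ∀ w z, ∫ t, g t * Complex.exp (z * (inner ℝ w t : ℝ)) =
      N * Complex.exp ((∑ j, w j * m j) / N * z +
        ((∑ j, ∑ k, (w j : ℂ) * w k * ∫ t, g t * (t j : ℂ) * (t k : ℂ)) / N -
          ((∑ j, w j * m j) / N) ^ 2) / 2 * z ^ 2) := by
    intro w z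
    have hD1 := hasDerivAt_integral_mul_cexp (hX w) (hexp w)
    have hD2 := hasDerivAt_integral_mul_cexp (hX w) (integrable_mul_mul_exp (hX w) (hexp w)) 0
    have h := Complex.eq_mul_exp_quadratic_of_growth hD1 hD2 (hne w)
      (C := (∫ t, ‖f t * (Real.exp (-(Real.pi / 2) * ‖t‖ ^ 2) : ℂ)‖) + 1)
      (K := ‖w‖ ^ 2 / (2 * Real.pi)) (by positivity) (fun z => by
        refine (hf.norm_integral_gaussian_mul_cexp_le w z).trans ?_
        gcongr
        linarith) z
    simp only [zero_mul, Complex.exp_zero, mul_one] at h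
    rwa [integral_mul_inner_eq_sum hm1, integral_mul_inner_sq_eq_sum hm2] at h
  -- Evaluate at `z = -2πi`: the matrix is `2π` times the covariance of the complex weight `g / N`.
  refine ⟨Matrix.of fun j k => 2 * Real.pi * ((∫ t, g t * (t j : ℂ) * (t k : ℂ)) / N -
    m j / N * (m k / N)), fun j => -Complex.I * (m j / N), Complex.log N, ?_, ?_⟩
  · ext j k
    have hcomm : ∫ t, g t * (t k : ℂ) * (t j : ℂ) = ∫ t, g t * (t j : ℂ) * (t k : ℂ) := by
      congr 1
      funext t
      ring
    simp only [Matrix.transpose_apply, Matrix.of_apply, hcomm, mul_comm (m k / N)]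
  · funext w
    have hF : 𝓕 g w = ∫ t, g t * Complex.exp ((-2 * Real.pi * Complex.I) * (inner ℝ w t : ℝ)) := by
      rw [Real.fourier_eq']
      congr 1
      funext t
      rw [smul_eq_mul, mul_comm, real_inner_comm]
      congr 2
      push_cast
      ring
    have hq : complexVec w ⬝ᵥ ((Matrix.of fun j k => 2 * Real.pi *
        ((∫ t, g t * (t j : ℂ) * (t k : ℂ)) / N - m j / N * (m k / N))) *ᵥ complexVec w) =
        2 * Real.pi * ((∑ j, ∑ k, (w j : ℂ) * w k * ∫ t, g t * (t j : ℂ) * (t k : ℂ)) / N -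
          ((∑ j, w j * m j) / N) ^ 2) := by
      rw [div_pow, sq (∑ j, w j * m j), Finset.sum_mul_sum, Finset.sum_div, Finset.sum_div,
        ← Finset.sum_sub_distrib, Finset.mul_sum]
      simp only [dotProduct, Matrix.mulVec, Matrix.of_apply, complexVec]
      refine Finset.sum_congr rfl fun j _ => ?_
      rw [Finset.sum_div, Finset.sum_div, ← Finset.sum_sub_distrib, Finset.mul_sum, Finset.mul_sum]
      refine Finset.sum_congr rfl fun k _ => ?_
      field_simp
    have hl : (fun j => -Complex.I * (m j / N)) ⬝ᵥ complexVec w =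
        -Complex.I * ((∑ j, w j * m j) / N) := by
      rw [Finset.sum_div, Finset.mul_sum]
      simp only [dotProduct, complexVec]
      exact Finset.sum_congr rfl fun j _ => by ring
    rw [hF, hline, gaussianFun, hq, hl, Complex.exp_add _ (Complex.log N), Complex.exp_log hN0,
      mul_comm N]
    congr 2
    rw [mul_pow, mul_pow, Complex.I_sq]
    ring

open scoped FourierTransform in
/-- The inverse Fourier transform moves `i t` into the linear term of the exponent, so it is the
integral of `gaussianFun B (b + i t) c`. -/
theorem exists_fourierInv_gaussianFun_eq {B : Matrix (Fin d) (Fin d) ℂ} (hB : B.IsSymm)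
    (hR : (B.map Complex.re).PosDef) (b : Fin d → ℂ) (c : ℂ) :
    ∃ (M : Matrix (Fin d) (Fin d) ℂ) (b' : Fin d → ℂ) (c' : ℂ), M.IsSymm ∧
      𝓕⁻ (gaussianFun B b c) = gaussianFun M b' c' := by
  obtain ⟨M, K, hM, hK, hint, -⟩ := exists_integral_gaussianFun_eq hB hR
  refine ⟨M, Complex.I • (M *ᵥ b), Complex.log K + (c + Real.pi * (b ⬝ᵥ (M *ᵥ b))), hM, ?_⟩
  funext t
  have h : 𝓕⁻ (gaussianFun B b c) t = ∫ w, gaussianFun B (b + Complex.I • complexVec t) c w := by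
    rw [Real.fourierInv_eq']
    congr 1
    funext w
    simp only [gaussianFun]
    rw [smul_eq_mul, ← Complex.exp_add, add_dotProduct, smul_dotProduct]
    congr 1
    have : ((inner ℝ w t : ℝ) : ℂ) = complexVec t ⬝ᵥ complexVec w := by
      simp [complexVec, dotProduct, PiLp.inner_apply]
    push_cast
    rw [this, smul_eq_mul]
    ring
  have hsymm : complexVec t ⬝ᵥ (M *ᵥ b) = b ⬝ᵥ (M *ᵥ complexVec t) := by
    rw [Matrix.dotProduct_mulVec, ← Matrix.mulVec_transpose, hM.eq, dotProduct_comm]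
  rw [h, hint, gaussianFun, ← Complex.exp_log hK, ← Complex.exp_add, Complex.exp_log hK]
  congr 1
  rw [Matrix.mulVec_add, Matrix.mulVec_smul]
  simp only [add_dotProduct, dotProduct_add, smul_dotProduct, dotProduct_smul, smul_eq_mul]
  rw [dotProduct_comm (M *ᵥ b), hsymm]
  linear_combination Real.pi * (complexVec t ⬝ᵥ (M *ᵥ complexVec t)) * Complex.I_sq

open scoped FourierTransform in
theorem isGeneralizedGaussian_of_wigner_pos (hf : MemLp f 2 volume)
    (hW : ∀ x ω, 0 < wigner f x ω) : IsGeneralizedGaussian f := by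
  -- `B` is the form of `𝓕 g`, `M` that of `g`, and undoing the factor `exp (-π ‖t‖²)` leaves `M - 1`.
  obtain ⟨B, b, c, hB, hF⟩ := exists_fourier_mul_gaussian_eq_gaussianFun hf hW
  set g : EuclideanSpace ℝ (Fin d) → ℂ := fun t => f t * (Real.exp (-Real.pi * ‖t‖ ^ 2) : ℂ) with hg
  have hgi : Integrable g := hf.integrable_mul_gaussian Real.pi_pos
  have hR : (B.map Complex.re).PosDef := by
    refine posDef_map_re_of_tendsto_zero hB (b := b) (c := c) ?_
    rw [← hF]
    exact tendsto_integral_exp_inner_smul_cocompact g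
  obtain ⟨M, b', c', hM, hinv⟩ := exists_fourierInv_gaussianFun_eq hB hR b c
  have hae := hgi.ae_eq_fourierInv_fourier (by rw [hF]; exact integrable_gaussianFun hB hR b c)
  rw [hF, hinv] at hae
  have hfae : f =ᵐ[volume] gaussianFun (M - 1) b' c' := by
    filter_upwards [hae] with t ht
    rw [gaussianFun_sub_one, ← ht, hg]
    simp only
    rw [mul_assoc, ← Complex.ofReal_mul, ← Real.exp_add]
    simp
  have hsymm : (M - 1).IsSymm := by
    rw [Matrix.IsSymm, Matrix.transpose_sub, hM.eq, Matrix.transpose_one]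
  have hpos : ((M - 1).map Complex.re).PosDef :=
    posDef_map_re_of_memLp hsymm ((memLp_congr_ae hfae).1 hf)
  exact ⟨M - 1, b', c', isUnit_of_posDef_map_re hsymm hpos, hsymm, hpos, hfae⟩

/-- The substitutions `t ↦ x ± t/2` preserve null sets. -/
theorem wigner_congr_ae {f₁ f₂ : EuclideanSpace ℝ (Fin d) → ℂ} (h : f₁ =ᵐ[volume] f₂) :
    wigner f₁ = wigner f₂ := by
  have hq : ∀ (x : EuclideanSpace ℝ (Fin d)) {r : ℝ}, r ≠ 0 →
      Measure.QuasiMeasurePreserving (fun t : EuclideanSpace ℝ (Fin d) => x + r • t) volume volume :=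
    fun x r hr => (measurePreserving_add_left volume x).quasiMeasurePreserving.comp
      (Measure.quasiMeasurePreserving_smul volume hr)
  funext x ω
  refine integral_congr_ae ?_
  have h1 := (hq x (r := 1 / 2) (by norm_num)).ae_eq_comp h
  have h2 := (hq x (r := -(1 / 2)) (by norm_num)).ae_eq_comp h
  filter_upwards [h1, h2] with t ht1 ht2
  simp only [Function.comp_apply, neg_smul, ← sub_eq_add_neg] at ht1 ht2
  rw [ht1, ht2]

theorem complexVec_dotProduct_mulVec_eq (A : Matrix (Fin d) (Fin d) ℂ)
    (u : EuclideanSpace ℝ (Fin d)) :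
    complexVec u ⬝ᵥ (A *ᵥ complexVec u) = ((u.ofLp ⬝ᵥ (A.map Complex.re *ᵥ u.ofLp) : ℝ) : ℂ) +
      ((u.ofLp ⬝ᵥ (A.map Complex.im *ᵥ u.ofLp) : ℝ) : ℂ) * Complex.I := by
  apply Complex.ext <;> simp [complexVec, dotProduct, Matrix.mulVec]

theorem dotProduct_complexVec_eq (b : Fin d → ℂ) (u : EuclideanSpace ℝ (Fin d)) :
    b ⬝ᵥ complexVec u = (((fun i => (b i).re) ⬝ᵥ u.ofLp : ℝ) : ℂ) +
      (((fun i => (b i).im) ⬝ᵥ u.ofLp : ℝ) : ℂ) * Complex.I := by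
  apply Complex.ext <;> simp [complexVec, dotProduct]

/-- The Wigner distribution of a generalized Gaussian is the Fourier transform of a real Gaussian,
hence positive. -/
theorem wigner_gaussianFun_pos {A : Matrix (Fin d) (Fin d) ℂ} (hA : A.IsSymm)
    (hR : (A.map Complex.re).PosDef) (b : Fin d → ℂ) (c : ℂ) (x ω : EuclideanSpace ℝ (Fin d)) :
    0 < wigner (gaussianFun A b c) x ω := by
  -- The integrand is a Gaussian in `t` with the real matrix `R = Re A / 2`, the imaginary linear
  -- coefficient `i η` and the real constant `p`.
  set R : Matrix (Fin d) (Fin d) ℂ := ((1 / 2 : ℝ) • A.map Complex.re).map Complex.ofReal with hRdef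
  have hRre : R.map Complex.re = (1 / 2 : ℝ) • A.map Complex.re := by
    ext i j; simp [hRdef]
  have hRim : R.map Complex.im = 0 := by
    ext i j; simp [hRdef]
  have hRs : R.IsSymm := by
    ext i j
    simp [hRdef, hA.apply i j]
  obtain ⟨M, K, -, -, hint, hreal⟩ := exists_integral_gaussianFun_eq hRs
    (by rw [hRre]; exact hR.smul (by norm_num))
  obtain ⟨hK, M', hM'⟩ := hreal hRim
  set η : EuclideanSpace ℝ (Fin d) := WithLp.toLp 2 fun i =>
    -ω i - (A.map Complex.im *ᵥ x.ofLp) i + (b i).im with hη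
  set p : ℝ := 2 * (-Real.pi * (x.ofLp ⬝ᵥ (A.map Complex.re *ᵥ x.ofLp)) +
    2 * Real.pi * ((fun i => (b i).re) ⬝ᵥ x.ofLp) + c.re) with hp
  have hval : ∀ t : EuclideanSpace ℝ (Fin d),
      gaussianFun A b c (x + (1 / 2 : ℝ) • t) *
        (starRingEnd ℂ) (gaussianFun A b c (x - (1 / 2 : ℝ) • t)) *
          Complex.exp (-2 * (Real.pi : ℂ) * Complex.I * ((inner ℝ ω t : ℝ) : ℂ)) =
      gaussianFun R (Complex.I • complexVec η) p t := by
    intro t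
    have hsymm : ∀ g : ℂ → ℝ, t.ofLp ⬝ᵥ (A.map g *ᵥ x.ofLp) = x.ofLp ⬝ᵥ (A.map g *ᵥ t.ofLp) :=
      fun g => by
        rw [Matrix.dotProduct_mulVec, ← Matrix.mulVec_transpose, ← Matrix.transpose_map, hA.eq,
          dotProduct_comm]
    have hηt : (fun i => ((Complex.I • complexVec η) i).im) ⬝ᵥ t.ofLp =
        -inner ℝ ω t - x.ofLp ⬝ᵥ (A.map Complex.im *ᵥ t.ofLp) + (fun i => (b i).im) ⬝ᵥ t.ofLp := by
      rw [← hsymm, dotProduct_comm t.ofLp]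
      simp only [dotProduct, PiLp.inner_apply, RCLike.inner_apply, conj_trivial]
      rw [← Finset.sum_neg_distrib, ← Finset.sum_sub_distrib, ← Finset.sum_add_distrib]
      refine Finset.sum_congr rfl fun i _ => ?_
      simp [hη, complexVec]
      ring
    have hηr : (fun i => ((Complex.I • complexVec η) i).re) = 0 := by
      funext i
      simp [complexVec]
    have hc : (starRingEnd ℂ) c = c.re - c.im * Complex.I := by
      apply Complex.ext <;> simp
    have hc' := Complex.re_add_im c
    simp only [gaussianFun, ← Complex.exp_conj, ← Complex.exp_add]
    congr 1
    rw [complexVec_dotProduct_mulVec_eq R, dotProduct_complexVec_eq _ t, hηt, hηr, hRre, hRim]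
    simp only [complexVec_dotProduct_mulVec_eq, dotProduct_complexVec_eq, map_add, map_mul, map_neg,
      Complex.conj_ofReal, Complex.conj_I, hc, WithLp.ofLp_add, WithLp.ofLp_sub, WithLp.ofLp_smul,
      Matrix.mulVec_add, Matrix.mulVec_sub, Matrix.mulVec_smul, Matrix.smul_mulVec,
      dotProduct_add, dotProduct_sub, add_dotProduct, sub_dotProduct, smul_dotProduct,
      dotProduct_smul, Matrix.zero_mulVec, dotProduct_zero, zero_dotProduct, smul_eq_mul, hsymm, hp,
      Complex.conj_ofNat]
    nth_rewrite 1 [← hc']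
    push_cast
    ring
  have hfinal : Complex.exp (p + Real.pi * ((Complex.I • complexVec η) ⬝ᵥ
      (M *ᵥ (Complex.I • complexVec η)))) =
      (Real.exp (p - Real.pi * (η.ofLp ⬝ᵥ (M' *ᵥ η.ofLp))) : ℂ) := by
    rw [Complex.ofReal_exp, Matrix.mulVec_smul, dotProduct_smul, smul_dotProduct, smul_smul,
      Complex.I_mul_I, hM']
    congr 1
    simp [complexVec, dotProduct, Matrix.mulVec]
    ring
  rw [wigner]
  simp_rw [hval]
  rw [hint, hfinal]
  exact mul_pos hK (Complex.zero_lt_real.2 (Real.exp_pos _))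

end Hudson

/-- Hudson's theorem. In `ℂ`, `0 < z` means that `z` is real and positive. -/
theorem mainTheorem12 (d : ℕ) (f : EuclideanSpace ℝ (Fin d) → ℂ) (hf : MemLp f 2 volume) :
    (∀ x ω : EuclideanSpace ℝ (Fin d), 0 < wigner f x ω) ↔ IsGeneralizedGaussian f := by
  refine ⟨isGeneralizedGaussian_of_wigner_pos hf, ?_⟩
  rintro ⟨A, b, c, -, hA, hR, hfae⟩ x ω
  rw [wigner_congr_ae hfae]
  exact wigner_gaussianFun_pos hA hR b c x ω
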